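/- Consider $N\ge 1$ parties $X^{(1)},\dots,X^{(N)}$, where $X^{(i)}$ has an input space $X^{(i)}_I$ and an output space $X^{(i)}_O$ of finite dimensions $d_{X^{(i)}_I},d_{X^{(i)}_O}\ge 1$. For a matrix $W$ on $\bigotimes_{i}(X^{(i)}_I\otimes X^{(i)}_O)$ and a set $S$ of these spaces, write ${}_SW=\frac{\mathbb 1_S}{d_S}\otimes\operatorname{tr}_SW$. * $W$ is a *process* ($W\in\mathtt{Proc}$) if $W\ge 0$ and $\operatorname{tr}[W^{\mathrm T}(M_1\otimes\cdots\otimes M_N)]=1$ for all Choi matrices $M_i$ of CPTP maps from $X^{(i)}_I$ to $X^{(i)}_O$, i.e. $M_i\ge 0$ with $\operatorname{tr}_{X^{(i)}_O}M_i=\mathbb 1_{X^{(i)}_I}$. * $W$ is *free* ($W\in\mathtt{Free}$) if $W=\rho\otimes\mathbb 1$ with $\rho$ a quantum state on the tensor product of all input spaces and $\mathbb 1$ the identity on all output spaces. * $W$ is *causally ordered* with order $X^{(1)}\prec\cdots\prec X^{(N)}$ if $W\ge 0$, $\operatorname{tr}W=\prod_{i=1}^N d_{X^{(i)}_O}$,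 and for every $k=1,\dots,N$, ${}_{L_k}W={}_{L_kX^{(k)}_O}W$, where $L_k$ is the set of all input and output spaces of $X^{(k+1)},\dots,X^{(N)}$ (for $k=N$: $W={}_{X^{(N)}_O}W$). * $W$ has $X^{(N)}$ as *definite last party* if $W\in\mathtt{Proc}$ and ${}_{X^{(N)}_O}W=W$. * The *signalling robustness* is $\mathcal R_s(W)=\min\{s\ge 0 : \exists\,T\in\mathtt{Proc},\ \frac{W+sT}{1+s}\in\mathtt{Free}\}$. **Proposition.** If $W$ is causally ordered with order $X^{(1)}\prec\cdots\prec X^{(N)}$, or, more generally, if $W$ is any process with $X^{(N)}$ as definite last party, then the minimum defining $\mathcal R_s(W)$ exists and $$\mathcal R_s(W)\le\prod_{i=1}^{N-1}d_{X^{(i)}_O}^2-1 .$$ -/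

import Mathlib

open scoped ComplexOrder

noncomputable section

namespace ProcMat

/-- The legs (elementary systems) of an `N`-party process: `Sum.inl i` is the input leg `X^(i)_I`
of party `i`, `Sum.inr i` is its output leg `X^(i)_O`. -/
abbrev Leg (N : ℕ) := Fin N ⊕ Fin N

/-- The input leg of party `i` (what party `i` receives). -/
abbrev inp {N : ℕ} (i : Fin N) : Leg N := Sum.inl i

/-- The output leg of party `i` (what party `i` sends forward). -/
abbrev out {N : ℕ} (i : Fin N) : Leg N := Sum.inr i

/-- The party to which a leg belongs. -/
def party {N : ℕ} (l : Leg N) : Fin N := Sum.elim id id l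

/-- The product basis of `⨂ l, ℂ ^ (d l)`. -/
abbrev Idx {ι : Type} (d : ι → ℕ) := (l : ι) → Fin (d l)

/-- Operators on `⨂ l, ℂ ^ (d l)`, as matrices in the product basis. -/
abbrev Op {ι : Type} (d : ι → ℕ) := Matrix (Idx d) (Idx d) ℂ

/-- Replace the coordinates of `x` in `S` by those of `z`. -/
def overwrite {ι : Type} [DecidableEq ι] {d : ι → ℕ} (S : Finset ι)
    (z : (l : {l // l ∈ S}) → Fin (d l)) (x : Idx d) : Idx d :=
  fun l => if h : l ∈ S then z ⟨l, h⟩ else x l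

/-- The operation `_S W = (𝟙_S / d_S) ⊗ tr_S W`: trace out the legs in `S` and replace them by the
maximally mixed state. -/
def depolarize {ι : Type} [DecidableEq ι] {d : ι → ℕ} (S : Finset ι) (W : Op d) : Op d :=
  Matrix.of fun x y =>
    if ∀ l ∈ S, x l = y l then
      (∏ l ∈ S, (d l : ℂ))⁻¹ *
        ∑ z : ((l : {l // l ∈ S}) → Fin (d l)), W (overwrite S z x) (overwrite S z y)
    else 0

/-- `M` is the Choi matrix of a CPTP map from `ℂ ^ a` to `ℂ ^ b`: `M ≥ 0` and `tr_b M = 𝟙_a`. -/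
structure IsChannel {a b : ℕ} (M : Matrix (Fin a × Fin b) (Fin a × Fin b) ℂ) : Prop where
  posSemidef : M.PosSemidef
  tracePreserving : ∀ k k' : Fin a,
    ∑ m : Fin b, M (k, m) (k', m) = (1 : Matrix (Fin a) (Fin a) ℂ) k k'

/-- The tensor product `M_1 ⊗ ⋯ ⊗ M_N` of local operators, `M_i` acting on the two legs of
party `i`. -/
def localOp {N : ℕ} {d : Leg N → ℕ}
    (M : (i : Fin N) →
      Matrix (Fin (d (inp i)) × Fin (d (out i))) (Fin (d (inp i)) × Fin (d (out i))) ℂ) :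
    Op d :=
  Matrix.of fun x y => ∏ i, M i (x (inp i), x (out i)) (y (inp i), y (out i))

/-- The set `Proc` of proper process matrices: `W ≥ 0` and `tr[Wᵀ (M_1 ⊗ ⋯ ⊗ M_N)] = 1` for all
Choi matrices `M_i` of CPTP maps of the parties. -/
structure IsProcess {N : ℕ} {d : Leg N → ℕ} (W : Op d) : Prop where
  posSemidef : W.PosSemidef
  normalized : ∀ M : (i : Fin N) →
      Matrix (Fin (d (inp i)) × Fin (d (out i))) (Fin (d (inp i)) × Fin (d (out i))) ℂ,
    (∀ i, IsChannel (M i)) → (W.transpose * localOp M).trace = 1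

/-- The set `Free` of non-signalling processes: `W = ρ ⊗ 𝟙` with `ρ` a quantum state on all the
input legs and `𝟙` the identity on all the output legs. -/
def IsFree {N : ℕ} {d : Leg N → ℕ} (W : Op d) : Prop :=
  ∃ ρ : Op (fun i : Fin N => d (inp i)), ρ.PosSemidef ∧ ρ.trace = 1 ∧
    ∀ x y, W x y = ρ (fun i => x (inp i)) (fun i => y (inp i)) *
      (1 : Op (fun i : Fin N => d (out i))) (fun i => x (out i)) (fun i => y (out i))

/-- All legs of the parties that come after party `k`. -/
def laterLegs {N : ℕ} (k : Fin N) : Finset (Leg N) :=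
  Finset.univ.filter fun l => k < party l

/-- Causally ordered processes (combs) with order `X^(1) ≺ ⋯ ≺ X^(N)`: `W ≥ 0`, the hierarchy of
trace conditions, and `tr W = ∏ d_O`. The condition for party `k` says that once all legs of the
later parties are traced out, `W` is of the form `𝟙_{X^(k)_O} ⊗ (rest)`; for the last party it is
`_{X^(N)_O} W = W`. -/
structure IsCausallyOrdered {N : ℕ} {d : Leg N → ℕ} (W : Op d) : Prop where
  posSemidef : W.PosSemidef
  hierarchy : ∀ k : Fin N,
    depolarize (laterLegs k) W = depolarize (insert (out k) (laterLegs k)) W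
  trace_eq : W.trace = ∏ i : Fin N, (d (out i) : ℂ)

/-- Proper processes for which party `k` is a definite last party, `_{X^(k)_O} W = W`: party `k`
cannot signal to any of the others. -/
structure HasLastParty {N : ℕ} {d : Leg N → ℕ} (k : Fin N) (W : Op d) : Prop where
  isProcess : IsProcess W
  last : depolarize {out k} W = W

/-- The noise weights `s ≥ 0` such that mixing `W` with some proper process `T` in the proportion
`1 : s` gives a free process. -/
def robustnessSet {N : ℕ} {d : Leg N → ℕ} (W : Op d) : Set ℝ :=
  {s | 0 ≤ s ∧ ∃ T : Op d, IsProcess T ∧ IsFree ((1 + s)⁻¹ • (W + s • T))}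

/-- The signalling robustness `R_s(W)`. -/
def signallingRobustness {N : ℕ} {d : Leg N → ℕ} (W : Op d) : ℝ :=
  sInf (robustnessSet W)

end ProcMat

end

/-! Let `S` be the outputs of all parties but the last, `D = d_S²` and `F = _S W`. Two facts give
the bound. First, `F` is free: depolarizing makes it the identity on `S`, `W` is already the
identity on the last output, and the trace of a process is the product of the output dimensions
(`HasLastParty.isFree_depolarize`). Second, `W ≤ D F` (`posSemidef_smul_depolarize_sub`), by a
pinching inequality.

Hence, for `D > 1`, `T = (D F - W) / (D - 1)` is positive. It is a process because normalization is
an affine condition satisfied by both `F` and `W`. Mixing `W` with weight `D - 1` of `T` gives back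
`F`, so `D - 1` is an admissible weight.

The minimum is attained because processes form a compact set and free ones a closed set. The
causally ordered case reduces to that of a definite last party: the hierarchy allows the channels to
be replaced, from the last to the first, by the maximally mixed one without changing the pairing
with `W`, which proves normalization. -/

namespace ProcMat

open Matrix

/-! ### Depolarization: self-adjointness, positivity and the pinching inequality -/

section Depolarize

variable {ι : Type} {d : ι → ℕ}

/-- The coordinates of `x` in `S`. -/
def restr (S : Finset ι) (x : Idx d) : (l : {l // l ∈ S}) → Fin (d l) := fun l => x l

theorem restr_eq_restr_iff (S : Finset ι) (x y : Idx d) :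
    restr S x = restr S y ↔ ∀ l ∈ S, x l = y l := by
  simp [funext_iff, restr]

theorem prod_dim_ne_zero (hd : ∀ l, 0 < d l) (S : Finset ι) : (∏ l ∈ S, (d l : ℂ)) ≠ 0 :=
  Finset.prod_ne_zero_iff.2 fun l _ => Nat.cast_ne_zero.2 (hd l).ne'

/-- The diagonal projection onto the coordinates `b` in `S`. -/
def proj [Fintype ι] (S : Finset ι) (b : (l : {l // l ∈ S}) → Fin (d l)) : Op d :=
  diagonal fun x => if restr S x = b then 1 else 0

theorem conjTranspose_proj [Fintype ι] (S : Finset ι) (b : (l : {l // l ∈ S}) → Fin (d l)) :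
    (proj S b)ᴴ = proj S b := by
  rw [proj, diagonal_conjTranspose]
  congr 1
  funext x
  by_cases h : restr S x = b <;> simp [h]

variable [DecidableEq ι]

theorem overwrite_of_mem {S : Finset ι} {l : ι} (h : l ∈ S) (z : (l : {l // l ∈ S}) → Fin (d l))
    (x : Idx d) : overwrite S z x l = z ⟨l, h⟩ := by
  simp [overwrite, h]

theorem overwrite_of_notMem {S : Finset ι} {l : ι} (h : l ∉ S)
    (z : (l : {l // l ∈ S}) → Fin (d l)) (x : Idx d) : overwrite S z x l = x l := by
  simp [overwrite, h]

theorem overwrite_overwrite (S : Finset ι) (z w : (l : {l // l ∈ S}) → Fin (d l)) (x : Idx d) :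
    overwrite S z (overwrite S w x) = overwrite S z x := by
  funext l
  by_cases h : l ∈ S <;> simp [overwrite, h]

theorem overwrite_restr (S : Finset ι) (x : Idx d) : overwrite S (restr S x) x = x := by
  funext l
  by_cases h : l ∈ S <;> simp [overwrite, restr, h]

theorem depolarize_apply_of_agree {S : Finset ι} (W : Op d) {x y : Idx d}
    (h : ∀ l ∈ S, x l = y l) :
    depolarize S W x y = (∏ l ∈ S, (d l : ℂ))⁻¹ *
      ∑ z : ((l : {l // l ∈ S}) → Fin (d l)), W (overwrite S z x) (overwrite S z y) := by
  simp only [depolarize, Matrix.of_apply, if_pos h]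

theorem depolarize_apply_of_not_agree {S : Finset ι} (W : Op d) {x y : Idx d}
    (h : ¬ ∀ l ∈ S, x l = y l) : depolarize S W x y = 0 := by
  simp only [depolarize, Matrix.of_apply, if_neg h]

theorem card_restr (S : Finset ι) :
    Fintype.card ((l : {l // l ∈ S}) → Fin (d l)) = ∏ l ∈ S, d l := by
  rw [Fintype.card_pi]
  simp only [Fintype.card_fin]
  exact Finset.prod_coe_sort S d

/-- A matrix that is block diagonal on `S` and does not depend on the block is unchanged by
depolarizing `S`. -/
theorem depolarize_eq_self_of_invariant (hd : ∀ l, 0 < d l) {S : Finset ι} {A : Op d}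
    (h0 : ∀ x y, (¬ ∀ l ∈ S, x l = y l) → A x y = 0)
    (h1 : ∀ x y z, (∀ l ∈ S, x l = y l) → A (overwrite S z x) (overwrite S z y) = A x y) :
    depolarize S A = A := by
  ext x y
  by_cases h : ∀ l ∈ S, x l = y l
  · rw [depolarize_apply_of_agree A h, Finset.sum_congr rfl fun z _ => h1 x y z h,
      Finset.sum_const, Finset.card_univ, card_restr, nsmul_eq_mul, Nat.cast_prod,
      inv_mul_cancel_left₀ (prod_dim_ne_zero hd S)]
  · rw [depolarize_apply_of_not_agree A h, h0 x y h]

theorem depolarize_empty (hd : ∀ l, 0 < d l) (W : Op d) : depolarize ∅ W = W := by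
  refine depolarize_eq_self_of_invariant hd (fun x y h => absurd (by simp) h) fun x y z _ => ?_
  congr 1

theorem apply_of_depolarize_eq_self {S : Finset ι} {W : Op d} (hW : depolarize S W = W)
    {x y : Idx d} (h : ¬ ∀ l ∈ S, x l = y l) : W x y = 0 := by
  rw [← hW, depolarize_apply_of_not_agree W h]

theorem apply_overwrite_of_depolarize_eq_self {S : Finset ι} {W : Op d}
    (hW : depolarize S W = W) {x y : Idx d} (h : ∀ l ∈ S, x l = y l)
    (w : (l : {l // l ∈ S}) → Fin (d l)) :
    W (overwrite S w x) (overwrite S w y) = W x y := by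
  have hw : ∀ l ∈ S, overwrite S w x l = overwrite S w y l := fun l hl => by
    rw [overwrite_of_mem hl, overwrite_of_mem hl]
  conv_lhs => rw [← hW]
  conv_rhs => rw [← hW]
  rw [depolarize_apply_of_agree W h, depolarize_apply_of_agree W hw]
  simp only [overwrite_overwrite]

/-- Averaging a function of a single coordinate. -/
theorem inv_prod_mul_sum_apply (hd : ∀ l, 0 < d l) {S : Finset ι} {l : ι} (hl : l ∈ S)
    (g : Fin (d l) → ℂ) :
    (∏ l ∈ S, (d l : ℂ))⁻¹ * ∑ z : ((l : {l // l ∈ S}) → Fin (d l)), g (z ⟨l, hl⟩) =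
      (d l : ℂ)⁻¹ * ∑ m, g m := by
  -- Splitting off coordinate `l`, the other coordinates contribute only their number, which cancels
  -- against the remaining factors of the prefactor.
  set e := Equiv.piSplitAt (⟨l, hl⟩ : {l // l ∈ S}) (fun l => Fin (d l))
  have h1 : ∑ z : ((l : {l // l ∈ S}) → Fin (d l)), g (z ⟨l, hl⟩) =
      ∑ p : Fin (d l) × ((j : {j : {l // l ∈ S} // j ≠ ⟨l, hl⟩}) → Fin (d j.1)), g p.1 :=
    Fintype.sum_equiv e _ _ fun z => rfl
  have h2 := Fintype.card_congr e
  rw [card_restr, Fintype.card_prod, Fintype.card_fin] at h2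
  have h3 := prod_dim_ne_zero hd S
  rw [← Nat.cast_prod, h2, Nat.cast_mul] at h3 ⊢
  rw [h1, Fintype.sum_prod_type]
  simp only [Finset.sum_const, Finset.card_univ, nsmul_eq_mul, ← Finset.mul_sum]
  have h4 := right_ne_zero_of_mul h3
  have h5 := left_ne_zero_of_mul h3
  field_simp

variable [Fintype ι]

/-- The bilinear pairing `tr[Aᵀ B]`. -/
theorem trace_transpose_mul {n : Type*} [Fintype n] (A B : Matrix n n ℂ) :
    (Aᵀ * B).trace = ∑ x, ∑ y, A x y * B x y := by
  simp only [Matrix.trace, Matrix.diag, Matrix.mul_apply, Matrix.transpose_apply]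
  exact Finset.sum_comm

/-- The pairing depends only on the partial traces over `S` of the two operators. The right-hand
side is symmetric in `A` and `B`, which is what self-adjointness needs. -/
theorem sum_depolarize_mul (S : Finset ι) (A B : Op d) :
    ∑ x, ∑ y, depolarize S A x y * B x y =
      (∏ l ∈ S, (d l : ℂ))⁻¹ * ∑ u : ((l : {l // l ∉ S}) → Fin (d l)),
        ∑ v : ((l : {l // l ∉ S}) → Fin (d l)),
        (∑ z, A ((Equiv.piEquivPiSubtypeProd (· ∈ S) fun l => Fin (d l)).symm (z, u))
          ((Equiv.piEquivPiSubtypeProd (· ∈ S) fun l => Fin (d l)).symm (z, v))) *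
        (∑ z, B ((Equiv.piEquivPiSubtypeProd (· ∈ S) fun l => Fin (d l)).symm (z, u))
          ((Equiv.piEquivPiSubtypeProd (· ∈ S) fun l => Fin (d l)).symm (z, v))) := by
  set e := Equiv.piEquivPiSubtypeProd (· ∈ S) fun l => Fin (d l)
  have hsum : ∀ f : Idx d → ℂ, ∑ x, f x = ∑ u, ∑ a, f (e.symm (a, u)) := fun f => by
    rw [← Equiv.sum_comp e.symm, Fintype.sum_prod_type, Finset.sum_comm]
  have how : ∀ z a u, overwrite S z (e.symm (a, u)) = e.symm (z, u) := fun z a u => by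
    funext l
    by_cases h : l ∈ S <;> simp [overwrite, h, e, Equiv.piEquivPiSubtypeProd]
  have hag : ∀ a u b v, (∀ l ∈ S, e.symm (a, u) l = e.symm (b, v) l) ↔ a = b := by
    intro a u b v
    rw [← restr_eq_restr_iff]
    have : ∀ a u, restr S (e.symm (a, u)) = a := fun a u => by
      funext l
      simp [restr, e, Equiv.piEquivPiSubtypeProd]
    rw [this, this]
  simp only [hsum, depolarize, Matrix.of_apply, how, hag]
  rw [Finset.mul_sum]
  refine Finset.sum_congr rfl fun u _ => ?_
  rw [Finset.sum_comm, Finset.mul_sum]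
  refine Finset.sum_congr rfl fun v _ => ?_
  simp only [ite_mul, zero_mul, Finset.sum_ite_eq, Finset.mem_univ, if_true]
  rw [← Finset.mul_sum, mul_assoc]

/-- Depolarization is self-adjoint for the pairing `tr[Aᵀ B]`. -/
theorem trace_transpose_depolarize_mul (S : Finset ι) (A B : Op d) :
    ((depolarize S A)ᵀ * B).trace = (Aᵀ * depolarize S B).trace := by
  rw [trace_transpose_mul, trace_transpose_mul, sum_depolarize_mul]
  simp_rw [mul_comm (A _ _) (depolarize S B _ _)]
  rw [sum_depolarize_mul]
  exact congrArg _ (Finset.sum_congr rfl fun u _ => Finset.sum_congr rfl fun v _ => mul_comm _ _)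

theorem depolarize_one (hd : ∀ l, 0 < d l) (S : Finset ι) : depolarize S (1 : Op d) = 1 := by
  refine depolarize_eq_self_of_invariant hd ?_ ?_
  · rintro x y h
    exact Matrix.one_apply_ne fun hxy => h fun l _ => by rw [hxy]
  · rintro x y z h
    simp only [Matrix.one_apply]
    congr 1
    refine propext ⟨fun hxy => ?_, fun hxy => by rw [hxy]⟩
    funext l
    by_cases hl : l ∈ S
    · exact h l hl
    · simpa [overwrite, hl] using congrFun hxy l

theorem trace_depolarize (hd : ∀ l, 0 < d l) (S : Finset ι) (W : Op d) :
    (depolarize S W).trace = W.trace := by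
  have := trace_transpose_depolarize_mul S W 1
  rwa [depolarize_one hd, mul_one, mul_one, trace_transpose, trace_transpose] at this

theorem proj_mul_mul_proj_apply (S : Finset ι) (a b : (l : {l // l ∈ S}) → Fin (d l)) (W : Op d)
    (x y : Idx d) :
    (proj S a * W * proj S b) x y =
      if restr S x = a then if restr S y = b then W x y else 0 else 0 := by
  rw [proj, proj, mul_diagonal, diagonal_mul]
  split_ifs <;> simp

theorem sum_proj (S : Finset ι) : ∑ b, proj S b = (1 : Op d) := by
  ext x y
  rw [Matrix.sum_apply]
  by_cases h : x = y
  · subst h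
    simp [proj]
  · simp [proj, h]

/-- The matrix obtained from `W` by fixing the coordinates in `S` to be `a`. -/
def fixCoord (S : Finset ι) (a : (l : {l // l ∈ S}) → Fin (d l)) (W : Op d) : Op d :=
  W.submatrix (overwrite S a) (overwrite S a)

/-- Writing the map as a sum of compressions of principal blocks makes positivity visible; the terms
`a = b` form the pinching of `W`. -/
theorem depolarize_eq_sum (S : Finset ι) (W : Op d) :
    depolarize S W = ((∏ l ∈ S, (d l : ℝ))⁻¹) •
      ∑ b, ∑ a, proj S b * fixCoord S a W * proj S b := by
  ext x y
  rw [Matrix.smul_apply, Matrix.sum_apply]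
  simp only [Matrix.sum_apply, proj_mul_mul_proj_apply, fixCoord, submatrix_apply]
  by_cases h : ∀ l ∈ S, x l = y l
  · rw [depolarize_apply_of_agree W h]
    rw [← restr_eq_restr_iff] at h
    rw [Finset.sum_comm]
    simp [h]
  · rw [depolarize_apply_of_not_agree W h]
    rw [← restr_eq_restr_iff] at h
    symm
    rw [smul_eq_zero]
    right
    refine Finset.sum_eq_zero fun b _ => Finset.sum_eq_zero fun a _ => ?_
    split_ifs with h1 h2
    · exact absurd (h1.trans h2.symm) h
    · rfl
    · rfl

theorem posSemidef_proj_mul_mul_proj {W : Op d} (hW : W.PosSemidef) (S : Finset ι)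
    (b : (l : {l // l ∈ S}) → Fin (d l)) : (proj S b * W * proj S b).PosSemidef := by
  have := hW.conjTranspose_mul_mul_same (proj S b)
  rwa [conjTranspose_proj] at this

theorem posSemidef_depolarize {W : Op d} (hW : W.PosSemidef) (S : Finset ι) :
    (depolarize S W).PosSemidef := by
  rw [depolarize_eq_sum]
  refine PosSemidef.smul (posSemidef_sum _ fun b _ => posSemidef_sum _ fun a _ =>
    posSemidef_proj_mul_mul_proj (hW.submatrix _) S b) ?_
  positivity

theorem proj_mul_fixCoord_mul_proj (S : Finset ι) (b : (l : {l // l ∈ S}) → Fin (d l))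
    (W : Op d) : proj S b * fixCoord S b W * proj S b = proj S b * W * proj S b := by
  ext x y
  rw [proj_mul_mul_proj_apply, proj_mul_mul_proj_apply]
  split_ifs with h1 h2
  · subst h1
    rw [fixCoord, submatrix_apply, overwrite_restr, ← h2, overwrite_restr]
  · rfl
  · rfl

/-- `∑_{a,b} (P_a - P_b) W (P_a - P_b) = 2 (m ∑_b P_b W P_b - W)` for a resolution of the identity
with `m` terms. -/
theorem sum_sub_mul_mul_sub {n κ : Type*} [Fintype n] [DecidableEq n] [Fintype κ]
    (P : κ → Matrix n n ℂ) (hP : ∑ b, P b = 1) (W : Matrix n n ℂ) :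
    ∑ a, ∑ b, (P a - P b) * W * (P a - P b) =
      (2 : ℝ) • ((Fintype.card κ : ℝ) • ∑ b, P b * W * P b - W) := by
  have h : ∀ a b, (P a - P b) * W * (P a - P b) =
      P a * W * P a + P b * W * P b - P a * W * P b - P b * W * P a := fun a b => by noncomm_ring
  have h1 : ∀ a, ∑ b, P a * W * P b = P a * W := fun a => by
    rw [← Finset.mul_sum, hP, mul_one]
  have h2 : ∀ a, ∑ b, P b * W * P a = W * P a := fun a => by
    rw [← Finset.sum_mul, ← Finset.sum_mul, hP, one_mul]
  have h3 : ∑ a, P a * W = W := by rw [← Finset.sum_mul, hP, one_mul]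
  have h4 : ∑ a, W * P a = W := by rw [← Finset.mul_sum, hP, mul_one]
  simp only [h, Finset.sum_sub_distrib, Finset.sum_add_distrib, h1, h2, h3, h4, Finset.sum_const,
    Finset.card_univ, ← Finset.smul_sum]
  rw [← Nat.cast_smul_eq_nsmul ℝ]
  module

/-- A positive semidefinite matrix is dominated by `d_S²` times its depolarization on `S`. -/
theorem posSemidef_smul_depolarize_sub (hd : ∀ l, 0 < d l) {W : Op d} (hW : W.PosSemidef)
    (S : Finset ι) : ((∏ l ∈ S, (d l : ℝ)) ^ 2 • depolarize S W - W).PosSemidef := by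
  set D : ℝ := ∏ l ∈ S, (d l : ℝ) with hD
  have hD0 : 0 < D := Finset.prod_pos fun l _ => Nat.cast_pos.2 (hd l)
  have hcard : (Fintype.card ((l : {l // l ∈ S}) → Fin (d l)) : ℝ) = D := by
    rw [card_restr, Nat.cast_prod]
  -- One factor `D` cancels the normalization of `depolarize`. The off-diagonal terms `a ≠ b` are
  -- positive and kept aside; the diagonal ones give `D ∑ P_b W P_b - W`, half the double sum of
  -- `sum_sub_mul_mul_sub`.
  have key : D ^ 2 • depolarize S W - W =
      D • ∑ b, ∑ a ∈ Finset.univ.erase b, proj S b * fixCoord S a W * proj S b +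
        (2⁻¹ : ℝ) • ∑ a, ∑ b, (proj S a - proj S b) * W * (proj S a - proj S b) := by
    have h : ∀ b, ∑ a, proj S b * fixCoord S a W * proj S b =
        ∑ a ∈ Finset.univ.erase b, proj S b * fixCoord S a W * proj S b +
          proj S b * W * proj S b := fun b => by
      rw [← proj_mul_fixCoord_mul_proj, Finset.sum_erase_add _ _ (Finset.mem_univ b)]
    rw [sum_sub_mul_mul_sub _ (sum_proj S), hcard, depolarize_eq_sum, smul_smul, ← hD, sq,
      mul_inv_cancel_right₀ hD0.ne', Finset.sum_congr rfl fun b _ => h b, Finset.sum_add_distrib]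
    module
  rw [key]
  refine PosSemidef.add (PosSemidef.smul (posSemidef_sum _ fun b _ => posSemidef_sum _ fun a _ =>
    posSemidef_proj_mul_mul_proj (hW.submatrix _) S b) hD0.le) (PosSemidef.smul
    (posSemidef_sum _ fun a _ => posSemidef_sum _ fun b _ => ?_) (by norm_num))
  have := hW.conjTranspose_mul_mul_same (proj S a - proj S b)
  rwa [conjTranspose_sub, conjTranspose_proj, conjTranspose_proj] at this

end Depolarize

/-! ### Causally ordered operators are processes with a definite last party -/

section CausalOrder

variable {N : ℕ} {d : Leg N → ℕ}

/-- The maximally mixed replacement channel. -/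
noncomputable def mixed (a b : ℕ) : Matrix (Fin a × Fin b) (Fin a × Fin b) ℂ := (b : ℂ)⁻¹ • 1

theorem mixed_apply_self {a b : ℕ} (p : Fin a × Fin b) : mixed a b p p = (b : ℂ)⁻¹ := by
  simp [mixed]

theorem mixed_apply_of_ne {a b : ℕ} {p q : Fin a × Fin b} (h : p ≠ q) : mixed a b p q = 0 := by
  simp [mixed, h]

theorem isChannel_mixed {a b : ℕ} (hb : 0 < b) : IsChannel (mixed a b) := by
  refine ⟨PosSemidef.one.smul ?_, fun k k' => ?_⟩
  · rw [inv_nonneg]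
    exact Nat.cast_nonneg b
  · have hb' : (b : ℂ) ≠ 0 := Nat.cast_ne_zero.2 hb.ne'
    by_cases h : k = k'
    · subst h
      simp [mixed_apply_self, hb']
    · rw [Matrix.one_apply_ne h]
      exact Finset.sum_eq_zero fun m _ => mixed_apply_of_ne fun h' => h (congrArg Prod.fst h')

theorem localOp_apply_eq_zero
    {M : (i : Fin N) →
      Matrix (Fin (d (inp i)) × Fin (d (out i))) (Fin (d (inp i)) × Fin (d (out i))) ℂ}
    {i : Fin N} {x y : Idx d} (hM : M i = mixed _ _)
    (h : (x (inp i), x (out i)) ≠ (y (inp i), y (out i))) : localOp M x y = 0 := by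
  rw [localOp, Matrix.of_apply]
  refine Finset.prod_eq_zero (Finset.mem_univ i) ?_
  rw [hM]
  exact mixed_apply_of_ne h

theorem localOp_mixed :
    localOp (fun i => mixed (d (inp i)) (d (out i))) =
      (∏ i : Fin N, (d (out i) : ℂ))⁻¹ • (1 : Op d) := by
  ext x y
  rw [Matrix.smul_apply, smul_eq_mul]
  by_cases h : x = y
  · subst h
    simp [localOp, mixed_apply_self, Finset.prod_inv_distrib]
  · rw [Matrix.one_apply_ne h, mul_zero]
    obtain ⟨l, hl⟩ := Function.ne_iff.1 h
    rcases l with i | i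
    · exact localOp_apply_eq_zero (i := i) rfl fun h' => hl (congrArg Prod.fst h')
    · exact localOp_apply_eq_zero (i := i) rfl fun h' => hl (congrArg Prod.snd h')

theorem prod_out_ne_zero (hd : ∀ l, 0 < d l) : (∏ i : Fin N, (d (out i) : ℂ)) ≠ 0 :=
  Finset.prod_ne_zero_iff.2 fun _ _ => Nat.cast_ne_zero.2 (hd _).ne'

theorem trace_transpose_mul_localOp_mixed (W : Op d) :
    (Wᵀ * localOp (fun i => mixed (d (inp i)) (d (out i)))).trace =
      (∏ i : Fin N, (d (out i) : ℂ))⁻¹ * W.trace := by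
  rw [localOp_mixed, Matrix.mul_smul, mul_one, trace_smul, trace_transpose, smul_eq_mul]

/-- Test normalization on maximally mixed channels, whose product is a multiple of the identity. -/
theorem IsProcess.trace_eq (hd : ∀ l, 0 < d l) {W : Op d} (hW : IsProcess W) :
    W.trace = ∏ i : Fin N, (d (out i) : ℂ) := by
  have h := hW.normalized _ fun i => isChannel_mixed (a := d (inp i)) (hd (out i))
  rw [trace_transpose_mul_localOp_mixed] at h
  rw [← mul_right_inj' (inv_ne_zero (prod_out_ne_zero hd)), h,
    inv_mul_cancel₀ (prod_out_ne_zero hd)]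

/-- Keep the first `k` channels and replace the others by the maximally mixed channel. -/
noncomputable def keepFirst (k : ℕ)
    (M : (i : Fin N) →
      Matrix (Fin (d (inp i)) × Fin (d (out i))) (Fin (d (inp i)) × Fin (d (out i))) ℂ) :
    (i : Fin N) →
      Matrix (Fin (d (inp i)) × Fin (d (out i))) (Fin (d (inp i)) × Fin (d (out i))) ℂ :=
  fun i => if i.val < k then M i else mixed _ _

variable {M : (i : Fin N) →
  Matrix (Fin (d (inp i)) × Fin (d (out i))) (Fin (d (inp i)) × Fin (d (out i))) ℂ}

theorem mem_laterLegs {k : Fin N} {l : Leg N} : l ∈ laterLegs k ↔ k < party l := by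
  simp [laterLegs]

theorem ne_of_leg_ne {x y : Idx d} {l : Leg N} (h : x l ≠ y l) :
    (x (inp (party l)), x (out (party l))) ≠ (y (inp (party l)), y (out (party l))) := by
  rcases l with i | i
  · exact fun h' => h (congrArg Prod.fst h')
  · exact fun h' => h (congrArg Prod.snd h')

theorem keepFirst_of_lt {k : Fin N} {i : Fin N} (h : k < i) :
    keepFirst (k.val + 1) M i = mixed _ _ :=
  if_neg (by have := Fin.lt_def.1 h; omega)

theorem keepFirst_apply_overwrite {k i : Fin N} (hi : k < i) {S : Finset (Leg N)} {x y : Idx d}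
    (hS : inp i ∈ S ∧ out i ∈ S) (h : ∀ l ∈ S, x l = y l)
    (z : (l : {l // l ∈ S}) → Fin (d l)) :
    keepFirst (k.val + 1) M i (overwrite S z x (inp i), overwrite S z x (out i))
      (overwrite S z y (inp i), overwrite S z y (out i)) =
    keepFirst (k.val + 1) M i (x (inp i), x (out i)) (y (inp i), y (out i)) := by
  rw [keepFirst_of_lt hi, overwrite_of_mem hS.1, overwrite_of_mem hS.1, overwrite_of_mem hS.2,
    overwrite_of_mem hS.2, mixed_apply_self, h _ hS.1, h _ hS.2, mixed_apply_self]

/-- The factors of the later parties are multiples of the identity, and the other factors do not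
involve the depolarized legs. -/
theorem depolarize_laterLegs_localOp_keepFirst (hd : ∀ l, 0 < d l) (k : Fin N) :
    depolarize (laterLegs k) (localOp (keepFirst (k.val + 1) M)) =
      localOp (keepFirst (k.val + 1) M) := by
  refine depolarize_eq_self_of_invariant hd (fun x y h => ?_) fun x y z h => ?_
  · push Not at h
    obtain ⟨l, hl, hxy⟩ := h
    exact localOp_apply_eq_zero (keepFirst_of_lt (mem_laterLegs.1 hl)) (ne_of_leg_ne hxy)
  · simp only [localOp, Matrix.of_apply]
    refine Finset.prod_congr rfl fun i _ => ?_
    by_cases hi : k < i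
    · exact keepFirst_apply_overwrite hi ⟨mem_laterLegs.2 hi, mem_laterLegs.2 hi⟩ h z
    · have h1 : inp i ∉ laterLegs k := fun h => hi (mem_laterLegs.1 h)
      have h2 : out i ∉ laterLegs k := fun h => hi (mem_laterLegs.1 h)
      rw [overwrite_of_notMem h1, overwrite_of_notMem h1, overwrite_of_notMem h2,
        overwrite_of_notMem h2]

/-- Trace preservation enters here: averaging over the output of party `k` turns `M k` into the
maximally mixed channel. -/
theorem depolarize_insert_localOp_keepFirst (hd : ∀ l, 0 < d l) (hM : ∀ i, IsChannel (M i))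
    (k : Fin N) :
    depolarize (insert (out k) (laterLegs k)) (localOp (keepFirst (k.val + 1) M)) =
      localOp (keepFirst k.val M) := by
  set S := insert (out k) (laterLegs k) with hS
  have hkS : out k ∈ S := Finset.mem_insert_self _ _
  have hk : keepFirst k.val M k = mixed _ _ := if_neg (lt_irrefl _)
  have hk' : keepFirst (k.val + 1) M k = M k := if_pos (Nat.lt_succ_self _)
  have hne : ∀ i, i ≠ k → keepFirst k.val M i = keepFirst (k.val + 1) M i := fun i hi => by
    have := Fin.val_ne_of_ne hi
    simp only [keepFirst]
    congr 1
    exact propext (by omega)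
  have hinS : ∀ i, inp i ∈ S ↔ k < i := fun i => by
    simp [hS, mem_laterLegs, party]
  have houtS : ∀ i, i ≠ k → (out i ∈ S ↔ k < i) := fun i hi => by
    simp [hS, mem_laterLegs, party, hi]
  ext x y
  by_cases h : ∀ l ∈ S, x l = y l
  · rw [depolarize_apply_of_agree _ h]
    have hterm : ∀ z : (l : {l // l ∈ S}) → Fin (d l),
        localOp (keepFirst (k.val + 1) M) (overwrite S z x) (overwrite S z y) =
          (∏ i ∈ Finset.univ.erase k,
            keepFirst k.val M i (x (inp i), x (out i)) (y (inp i), y (out i))) *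
          M k (x (inp k), z ⟨out k, hkS⟩) (y (inp k), z ⟨out k, hkS⟩) := fun z => by
      have hk1 : inp k ∉ S := fun h => lt_irrefl _ ((hinS k).1 h)
      rw [localOp, Matrix.of_apply, ← Finset.prod_erase_mul _ _ (Finset.mem_univ k), hk',
        overwrite_of_mem hkS, overwrite_of_mem hkS, overwrite_of_notMem hk1,
        overwrite_of_notMem hk1]
      congr 1
      refine Finset.prod_congr rfl fun i hi => ?_
      have hi := Finset.ne_of_mem_erase hi
      rw [hne i hi]
      by_cases hki : k < i
      · exact keepFirst_apply_overwrite hki ⟨(hinS i).2 hki, (houtS i hi).2 hki⟩ h z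
      · have h1 : inp i ∉ S := fun h => hki ((hinS i).1 h)
        have h2 : out i ∉ S := fun h => hki ((houtS i hi).1 h)
        rw [overwrite_of_notMem h1, overwrite_of_notMem h1, overwrite_of_notMem h2,
          overwrite_of_notMem h2]
    rw [Finset.sum_congr rfl fun z _ => hterm z,
      inv_prod_mul_sum_apply hd hkS fun m => (∏ i ∈ Finset.univ.erase k,
        keepFirst k.val M i (x (inp i), x (out i)) (y (inp i), y (out i))) *
          M k (x (inp k), m) (y (inp k), m), ← Finset.mul_sum, (hM k).tracePreserving,
      localOp, Matrix.of_apply, ← Finset.prod_erase_mul _ _ (Finset.mem_univ k), hk,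
      mul_left_comm]
    congr 1
    by_cases hin : x (inp k) = y (inp k)
    · rw [hin, h _ hkS, mixed_apply_self, Matrix.one_apply_eq, mul_one]
    · rw [Matrix.one_apply_ne hin, mul_zero,
        mixed_apply_of_ne fun h' => hin (congrArg Prod.fst h')]
  · rw [depolarize_apply_of_not_agree _ h]
    push Not at h
    obtain ⟨l, hl, hxy⟩ := h
    symm
    refine localOp_apply_eq_zero ?_ (ne_of_leg_ne hxy)
    rcases Finset.mem_insert.1 hl with rfl | hl
    · exact hk
    · have hl := mem_laterLegs.1 hl
      rw [hne _ hl.ne']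
      exact keepFirst_of_lt hl

theorem IsCausallyOrdered.isProcess (hd : ∀ l, 0 < d l) {W : Op d} (hW : IsCausallyOrdered W) :
    IsProcess W := by
  refine ⟨hW.posSemidef, fun M hM => ?_⟩
  have key : ∀ k ≤ N, (Wᵀ * localOp (keepFirst k M)).trace = 1 := by
    intro k
    induction k with
    | zero =>
      intro _
      have : keepFirst 0 M = fun i => mixed (d (inp i)) (d (out i)) :=
        funext fun i => if_neg (Nat.not_lt_zero _)
      rw [this, trace_transpose_mul_localOp_mixed, hW.trace_eq,
        inv_mul_cancel₀ (prod_out_ne_zero hd)]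
    | succ k ih =>
      intro hk
      rw [← ih (Nat.le_of_succ_le hk)]
      have h1 := depolarize_laterLegs_localOp_keepFirst (M := M) hd ⟨k, hk⟩
      have h2 := depolarize_insert_localOp_keepFirst hd hM ⟨k, hk⟩
      dsimp only at h1 h2
      -- The depolarization of the later legs is moved onto `W`, enlarged there by the hierarchy,
      -- and moved back, where it erases the channel of party `k`.
      rw [← h1, ← trace_transpose_depolarize_mul, hW.hierarchy, trace_transpose_depolarize_mul, h2]
  have hN : keepFirst N M = M := funext fun i => if_pos i.2
  rw [← hN]
  exact key N le_rfl

theorem IsCausallyOrdered.hasLastParty {n : ℕ} {d : Leg (n + 1) → ℕ} (hd : ∀ l, 0 < d l)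
    {W : Op d} (hW : IsCausallyOrdered W) : HasLastParty (Fin.last n) W := by
  refine ⟨hW.isProcess hd, ?_⟩
  have h : laterLegs (Fin.last n) = ∅ :=
    Finset.eq_empty_of_forall_notMem fun l hl => not_lt_of_ge (Fin.le_last _) (mem_laterLegs.1 hl)
  have h' := hW.hierarchy (Fin.last n)
  rw [h, depolarize_empty hd] at h'
  exact h'.symm

end CausalOrder

/-! ### Free processes -/

section Free

variable {N : ℕ} {d : Leg N → ℕ}

/-- The basis index with input coordinates `a` and output coordinates `b`. -/
def joinIdx (a : Idx fun i : Fin N => d (inp i)) (b : Idx fun i : Fin N => d (out i)) : Idx d :=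
  (Equiv.sumPiEquivProdPi fun l => Fin (d l)).symm (a, b)

theorem joinIdx_inp (a : Idx fun i : Fin N => d (inp i)) (b : Idx fun i : Fin N => d (out i))
    (i : Fin N) : joinIdx a b (inp i) = a i :=
  rfl

theorem joinIdx_out (a : Idx fun i : Fin N => d (inp i)) (b : Idx fun i : Fin N => d (out i))
    (i : Fin N) : joinIdx a b (out i) = b i :=
  rfl

theorem sum_joinIdx (f : Idx d → ℂ) : ∑ x, f x = ∑ a, ∑ b, f (joinIdx a b) := by
  rw [← Equiv.sum_comp (Equiv.sumPiEquivProdPi fun l => Fin (d l)).symm, Fintype.sum_prod_type]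
  rfl

/-- The block of `V` with all output coordinates equal to `o`. -/
def inputBlock (o : Idx fun i : Fin N => d (out i)) (V : Op d) :
    Op (fun i : Fin N => d (inp i)) :=
  V.submatrix (fun a => joinIdx a o) (fun a => joinIdx a o)

/-- The state `ρ` can be read off any one output block. Removing the existential turns freeness into
closed conditions on `V`. -/
theorem isFree_iff (o : Idx fun i : Fin N => d (out i)) (V : Op d) :
    IsFree V ↔ (inputBlock o V).PosSemidef ∧ (inputBlock o V).trace = 1 ∧
      ∀ x y, V x y = inputBlock o V (fun i => x (inp i)) (fun i => y (inp i)) *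
        (1 : Op (fun i : Fin N => d (out i))) (fun i => x (out i)) (fun i => y (out i)) := by
  constructor
  · rintro ⟨ρ, hρ, htr, hV⟩
    have : inputBlock o V = ρ := by
      ext a b
      have h : V (joinIdx a o) (joinIdx b o) = ρ a b *
        (1 : Op (fun i : Fin N => d (out i))) o o := hV _ _
      rwa [Matrix.one_apply_eq, mul_one] at h
    rw [this]
    exact ⟨hρ, htr, hV⟩
  · rintro ⟨h1, h2, h3⟩
    exact ⟨_, h1, h2, h3⟩

/-- The identity on the outputs traces out each channel's output, leaving the identity on the inputs
by trace preservation, so the pairing equals `tr ρ`. -/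
theorem IsFree.isProcess {V : Op d} (hV : IsFree V) : IsProcess V := by
  obtain ⟨ρ, hρ, htr, hV⟩ := hV
  refine ⟨?_, fun M hM => ?_⟩
  · have : V = (kroneckerMap (· * ·) ρ (1 : Op (fun i : Fin N => d (out i)))).submatrix
        (fun x => (fun i => x (inp i), fun i => x (out i)))
        (fun x => (fun i => x (inp i), fun i => x (out i))) := by
      ext x y
      exact hV x y
    rw [this]
    exact (hρ.kronecker PosSemidef.one).submatrix _
  · have hVj : ∀ a b a' b', V (joinIdx a b) (joinIdx a' b') = ρ a a' *
        (1 : Op (fun i : Fin N => d (out i))) b b' := fun a b a' b' => hV _ _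
    have h : ∀ a a', ∑ b, ∑ b', V (joinIdx a b) (joinIdx a' b') *
        localOp M (joinIdx a b) (joinIdx a' b') = if a = a' then ρ a a' else 0 := fun a a' => by
      have h1 : ∀ b, ∑ b', V (joinIdx a b) (joinIdx a' b') *
          localOp M (joinIdx a b) (joinIdx a' b') = ρ a a' * ∏ i, M i (a i, b i) (a' i, b i) :=
        fun b => by
          rw [Finset.sum_eq_single b]
          · simp [hVj, localOp, joinIdx_inp, joinIdx_out]
          · intro b' _ hb
            simp [hVj, Matrix.one_apply_ne hb.symm]
          · simp
      have h2 := Fintype.prod_sum fun (i : Fin N) (m : Fin (d (out i))) => M i (a i, m) (a' i, m)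
      rw [Finset.sum_congr rfl fun b _ => h1 b, ← Finset.mul_sum, ← h2]
      by_cases haa : a = a'
      · subst haa
        simp [(hM _).tracePreserving]
      · obtain ⟨i, hi⟩ := Function.ne_iff.1 haa
        rw [Finset.prod_eq_zero (Finset.mem_univ i), mul_zero, if_neg haa]
        rw [(hM i).tracePreserving, Matrix.one_apply_ne hi]
    rw [trace_transpose_mul, sum_joinIdx]
    simp_rw [sum_joinIdx (d := d)]
    rw [← htr, Matrix.trace]
    refine Finset.sum_congr rfl fun a _ => ?_
    rw [Finset.sum_comm]
    simp [h]

theorem isFree_of_invariant (hd : ∀ l, 0 < d l) {V : Op d} (hpos : V.PosSemidef)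
    (htr : V.trace = ∏ i : Fin N, (d (out i) : ℂ))
    (o : Idx fun i : Fin N => d (out i))
    (h0 : ∀ x y, (∃ i, x (out i) ≠ y (out i)) → V x y = 0)
    (h1 : ∀ x y, (∀ i, x (out i) = y (out i)) →
      V x y = V (joinIdx (fun i => x (inp i)) o) (joinIdx (fun i => y (inp i)) o)) :
    IsFree V := by
  rw [isFree_iff o]
  refine ⟨hpos.submatrix _, ?_, fun x y => ?_⟩
  · have h2 : V.trace = (∏ i : Fin N, (d (out i) : ℂ)) * (inputBlock o V).trace := by
      rw [Matrix.trace, sum_joinIdx]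
      simp only [Matrix.diag]
      have : ∀ a b, V (joinIdx a b) (joinIdx a b) = V (joinIdx a o) (joinIdx a o) := fun a b =>
        h1 _ _ fun _ => rfl
      simp only [this, Finset.sum_const, Finset.card_univ, nsmul_eq_mul, ← Finset.mul_sum]
      rw [Fintype.card_pi]
      simp [Matrix.trace, inputBlock]
    rw [htr] at h2
    exact (mul_right_eq_self₀.1 h2.symm).resolve_right (prod_out_ne_zero hd)
  · by_cases h : ∀ i, x (out i) = y (out i)
    · rw [h1 x y h, funext h, Matrix.one_apply_eq, mul_one]
      rfl
    · push Not at h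
      rw [h0 x y h, Matrix.one_apply_ne, mul_zero]
      exact Function.ne_iff.2 h

end Free

/-! ### Compactness and existence of the minimum -/

section Compactness

theorem isClosed_posSemidef {n : Type*} [Fintype n] :
    IsClosed {W : Matrix n n ℂ | W.PosSemidef} := by
  simp only [posSemidef_iff_dotProduct_mulVec, Matrix.IsHermitian, Set.ofPred_and, Set.ofPred_forall]
  refine (isClosed_eq (by fun_prop) continuous_id).inter (isClosed_iInter fun x => ?_)
  exact isClosed_le continuous_const (by fun_prop)

theorem norm_sq_apply_le {n : Type*} [Fintype n] [DecidableEq n] {W : Matrix n n ℂ}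
    (hW : W.PosSemidef) (x y : n) : ‖W x y‖ ^ 2 ≤ (W x x).re * (W y y).re := by
  -- The minor on rows `x`, `y` is nonnegative; for `x = y` the repeated row is harmless.
  have h := (hW.submatrix ![x, y]).det_nonneg
  have hxy : W y x = star (W x y) := (hW.isHermitian.apply y x).symm
  have hx := Complex.nonneg_iff.1 (hW.diag_nonneg (i := x))
  have hy := Complex.nonneg_iff.1 (hW.diag_nonneg (i := y))
  rw [Matrix.det_fin_two] at h
  simp only [submatrix_apply, cons_val_zero, cons_val_one, hxy] at h
  have h' := (Complex.nonneg_iff.1 h).1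
  rw [Complex.sub_re, Complex.mul_re, ← hx.2, ← hy.2, Complex.star_def, Complex.mul_conj,
    Complex.ofReal_re, Complex.normSq_eq_norm_sq] at h'
  linarith

theorem norm_apply_le_trace {n : Type*} [Fintype n] [DecidableEq n] {W : Matrix n n ℂ}
    (hW : W.PosSemidef) (x y : n) : ‖W x y‖ ≤ W.trace.re := by
  have hnn : ∀ x, 0 ≤ (W x x).re := fun x => (Complex.nonneg_iff.1 hW.diag_nonneg).1
  have hle : ∀ x, (W x x).re ≤ W.trace.re := fun x => by
    rw [Matrix.trace, Complex.re_sum]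
    exact Finset.single_le_sum (f := fun x => (W x x).re) (fun i _ => hnn i) (Finset.mem_univ x)
  have h0 : 0 ≤ W.trace.re := (hnn x).trans (hle x)
  refine abs_le_of_sq_le_sq' ?_ h0 |>.2
  calc ‖W x y‖ ^ 2 ≤ (W x x).re * (W y y).re := norm_sq_apply_le hW x y
    _ ≤ W.trace.re * W.trace.re := mul_le_mul (hle x) (hle y) (hnn y) h0
    _ = W.trace.re ^ 2 := (sq _).symm

variable {N : ℕ} {d : Leg N → ℕ}

theorem isClosed_isProcess : IsClosed {T : Op d | IsProcess T} := by
  have : {T : Op d | IsProcess T} = {T | T.PosSemidef} ∩ ⋂ M, ⋂ (_ : ∀ i, IsChannel (M i)),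
      {T | (Tᵀ * localOp M).trace = 1} := by
    ext T
    simp only [Set.mem_inter_iff, Set.mem_iInter, Set.mem_ofPred_eq]
    exact ⟨fun h => ⟨h.1, h.2⟩, fun h => ⟨h.1, h.2⟩⟩
  rw [this]
  refine isClosed_posSemidef.inter (isClosed_iInter fun M => isClosed_iInter fun _ => ?_)
  exact isClosed_eq (by fun_prop) continuous_const

/-- Positivity bounds every entry by the trace, which is the same for all processes. -/
theorem isCompact_isProcess (hd : ∀ l, 0 < d l) : IsCompact {T : Op d | IsProcess T} := by
  have hK : IsCompact {T : Op d | ∀ x, T x ∈ {r : Idx d → ℂ | ∀ y, r y ∈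
      Metric.closedBall (0 : ℂ) (∏ i : Fin N, (d (out i) : ℂ)).re}} :=
    isCompact_pi_infinite fun _ => isCompact_pi_infinite fun _ => isCompact_closedBall _ _
  refine hK.of_isClosed_subset isClosed_isProcess fun T hT x y => ?_
  rw [mem_closedBall_zero_iff, ← IsProcess.trace_eq hd hT]
  exact norm_apply_le_trace hT.posSemidef x y

theorem isClosed_isFree (hd : ∀ l, 0 < d l) : IsClosed {V : Op d | IsFree V} := by
  have o : Idx fun i : Fin N => d (out i) := fun i => ⟨0, hd _⟩
  have hc : Continuous fun V : Op d => inputBlock o V := by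
    unfold inputBlock
    fun_prop
  simp only [isFree_iff o, Set.ofPred_and, Set.ofPred_forall]
  refine (isClosed_posSemidef.preimage hc).inter ((isClosed_eq (by fun_prop)
    continuous_const).inter (isClosed_iInter fun x => isClosed_iInter fun y => ?_))
  refine isClosed_eq (by fun_prop) (Continuous.mul ?_ continuous_const)
  exact hc.matrix_elem _ _

/-- The signalling robustness is attained as soon as some noise weight makes the process free. -/
theorem isLeast_signallingRobustness (hd : ∀ l, 0 < d l) {W : Op d} {s₀ : ℝ}
    (hs₀ : s₀ ∈ robustnessSet W) :
    IsLeast (robustnessSet W) (signallingRobustness W) := by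
  have hbdd : BddBelow (robustnessSet W) := ⟨0, fun s hs => hs.1⟩
  -- Weights above `s₀` are irrelevant to the minimum; cutting them off makes the set of pairs `(s,
  -- T)` compact.
  set K : Set (ℝ × Op d) := Set.Icc 0 s₀ ×ˢ {T | IsProcess T} with hK
  have hKc : IsCompact K := isCompact_Icc.prod (isCompact_isProcess hd)
  have hf : ContinuousOn (fun p : ℝ × Op d => (1 + p.1)⁻¹ • (W + p.1 • p.2)) K := by
    have h1 : Continuous fun p : ℝ × Op d => 1 + p.1 := by fun_prop
    have h2 : Continuous fun p : ℝ × Op d => W + p.1 • p.2 := by fun_prop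
    refine (h1.continuousOn.inv₀ fun p hp => ?_).smul h2.continuousOn
    have := hp.1.1
    positivity
  have hC : IsCompact (K ∩ (fun p : ℝ × Op d => (1 + p.1)⁻¹ • (W + p.1 • p.2)) ⁻¹'
      {V | IsFree V}) :=
    hKc.of_isClosed_subset (hf.preimage_isClosed_of_isClosed hKc.isClosed (isClosed_isFree hd))
      Set.inter_subset_left
  obtain ⟨T₀, hT₀, hF₀⟩ := hs₀.2
  obtain ⟨⟨s, T⟩, ⟨⟨hs, hT⟩, hF⟩, hmin⟩ := hC.exists_isMinOn
    ⟨(s₀, T₀), ⟨⟨Set.right_mem_Icc.2 hs₀.1, hT₀⟩, hF₀⟩⟩ continuous_fst.continuousOn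
  have hleast : IsLeast (robustnessSet W) s := by
    refine ⟨⟨hs.1, T, hT, hF⟩, fun t ht => ?_⟩
    obtain ⟨T', hT', hF'⟩ := ht.2
    rcases le_total t s₀ with h | h
    · exact hmin (a := (t, T')) ⟨⟨⟨ht.1, h⟩, hT'⟩, hF'⟩
    · exact hs.2.trans h
  rw [signallingRobustness, hleast.csInf_eq]
  exact hleast

end Compactness

/-! ### The bound for a definite last party -/

section LastParty

variable {n : ℕ} {d : Leg (n + 1) → ℕ}

/-- The output legs of all the parties but the last one. -/
def earlierOutputs (n : ℕ) : Finset (Leg (n + 1)) :=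
  Finset.univ.image fun i : Fin n => out i.castSucc

theorem inp_notMem_earlierOutputs (i : Fin (n + 1)) : inp i ∉ earlierOutputs n := by
  simp [earlierOutputs]

theorem out_last_notMem_earlierOutputs : out (Fin.last n) ∉ earlierOutputs n := by
  simp [earlierOutputs]

theorem out_castSucc_mem_earlierOutputs (i : Fin n) : out i.castSucc ∈ earlierOutputs n := by
  simp [earlierOutputs]

theorem prod_earlierOutputs :
    ∏ l ∈ earlierOutputs n, (d l : ℝ) = ∏ i : Fin n, (d (out i.castSucc) : ℝ) := by
  rw [earlierOutputs, Finset.prod_image]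
  intro i _ j _ h
  exact Fin.castSucc_injective n (Sum.inr_injective h)

/-- Depolarizing the outputs of the earlier parties makes a process with a definite last party
free. -/
theorem HasLastParty.isFree_depolarize (hd : ∀ l, 0 < d l) {W : Op d}
    (hW : HasLastParty (Fin.last n) W) : IsFree (depolarize (earlierOutputs n) W) := by
  have o : Idx fun i : Fin (n + 1) => d (out i) := fun i => ⟨0, hd _⟩
  refine isFree_of_invariant hd (posSemidef_depolarize hW.isProcess.posSemidef _)
    ((trace_depolarize hd _ _).trans (hW.isProcess.trace_eq hd)) o ?_ ?_
  · rintro x y ⟨i, hi⟩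
    by_cases h : ∀ l ∈ earlierOutputs n, x l = y l
    · rw [depolarize_apply_of_agree _ h]
      refine mul_eq_zero_of_right _ (Finset.sum_eq_zero fun z _ => ?_)
      refine apply_of_depolarize_eq_self hW.last fun h' => ?_
      have h'' := h' _ (Finset.mem_singleton_self _)
      rw [overwrite_of_notMem out_last_notMem_earlierOutputs,
        overwrite_of_notMem out_last_notMem_earlierOutputs] at h''
      rcases Fin.eq_castSucc_or_eq_last i with ⟨j, rfl⟩ | rfl
      · exact hi (h _ (out_castSucc_mem_earlierOutputs j))
      · exact hi h''
    · exact depolarize_apply_of_not_agree _ h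
  · intro x y hxy
    have hS : ∀ l ∈ earlierOutputs n, x l = y l := by
      rintro (i | i) hl
      · exact absurd hl (inp_notMem_earlierOutputs i)
      · exact hxy i
    rw [depolarize_apply_of_agree _ hS, depolarize_apply_of_agree]
    · congr 1
      refine Finset.sum_congr rfl fun z _ => ?_
      -- After overwriting the earlier outputs, passing to the reference outputs `o` changes only
      -- the last output, in which `W` is invariant.
      have key : ∀ x : Idx d, overwrite (earlierOutputs n) z (joinIdx (fun i => x (inp i)) o) =
          overwrite {out (Fin.last n)} (restr _ (joinIdx (fun i => x (inp i)) o))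
            (overwrite (earlierOutputs n) z x) := fun x => by
        funext l
        rcases l with i | i
        · rw [overwrite_of_notMem (inp_notMem_earlierOutputs i), overwrite_of_notMem (by simp),
            overwrite_of_notMem (inp_notMem_earlierOutputs i)]
          rfl
        · rcases Fin.eq_castSucc_or_eq_last i with ⟨j, rfl⟩ | rfl
          · rw [overwrite_of_mem (out_castSucc_mem_earlierOutputs j), overwrite_of_notMem,
              overwrite_of_mem (out_castSucc_mem_earlierOutputs j)]
            simp [Fin.castSucc_ne_last]
          · rw [overwrite_of_notMem out_last_notMem_earlierOutputs,
              overwrite_of_mem (Finset.mem_singleton_self _)]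
            rfl
      have hres : restr {out (Fin.last n)} (joinIdx (fun i => x (inp i)) o) =
          restr {out (Fin.last n)} (joinIdx (fun i => y (inp i)) o) := by
        rw [restr_eq_restr_iff]
        simp [joinIdx_out]
      rw [key, key, hres]
      refine (apply_overwrite_of_depolarize_eq_self hW.last (fun l hl => ?_) _).symm
      rw [Finset.mem_singleton.1 hl, overwrite_of_notMem out_last_notMem_earlierOutputs,
        overwrite_of_notMem out_last_notMem_earlierOutputs, hxy]
    · rintro (i | i) hl
      · exact absurd hl (inp_notMem_earlierOutputs i)
      · rfl

theorem HasLastParty.mem_robustnessSet (hd : ∀ l, 0 < d l) {W : Op d}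
    (hW : HasLastParty (Fin.last n) W) :
    (∏ i : Fin n, (d (out i.castSucc) : ℝ) ^ 2) - 1 ∈ robustnessSet W := by
  set D : ℝ := ∏ i : Fin n, (d (out i.castSucc) : ℝ) ^ 2 with hD
  have hD1 : 1 ≤ D := by
    have h : ∀ i : Fin n, (1 : ℝ) ≤ (d (out i.castSucc) : ℝ) ^ 2 := fun i =>
      one_le_pow₀ (Nat.one_le_cast.2 (hd _))
    simpa using Finset.prod_le_prod (s := Finset.univ) (fun _ _ => zero_le_one) fun i _ => h i
  have hfree := hW.isFree_depolarize hd
  set F := depolarize (earlierOutputs n) W with hF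
  have hpos : (D • F - W).PosSemidef := by
    have h := posSemidef_smul_depolarize_sub hd hW.isProcess.posSemidef (earlierOutputs n)
    rwa [prod_earlierOutputs, ← Finset.prod_pow] at h
  refine ⟨sub_nonneg.2 hD1, ?_⟩
  -- If `D = 1`, one cannot divide by `D - 1`; but then `F - W` is positive with trace zero, so `W =
  -- F` is itself free and any process serves as noise of weight zero.
  rcases hD1.eq_or_lt with h1 | h1
  · refine ⟨W, hW.isProcess, ?_⟩
    have hFW : F - W = 0 := by
      rw [← h1, one_smul] at hpos
      rw [← hpos.trace_eq_zero_iff, trace_sub, hF, trace_depolarize hd, sub_self]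
    rw [← h1, sub_self, zero_smul, add_zero, add_zero, inv_one, one_smul, ← sub_eq_zero.1 hFW]
    exact hfree
  · have hD0 : D - 1 ≠ 0 := (sub_pos.2 h1).ne'
    refine ⟨(D - 1)⁻¹ • (D • F - W), ⟨hpos.smul (inv_nonneg.2 (sub_nonneg.2 hD1)),
      fun M hM => ?_⟩, ?_⟩
    · rw [transpose_smul, transpose_sub, transpose_smul, smul_mul, trace_smul, sub_mul, trace_sub,
        smul_mul, trace_smul, hfree.isProcess.normalized M hM, hW.isProcess.normalized M hM]
      have : D • (1 : ℂ) - 1 = (D - 1) • (1 : ℂ) := by rw [sub_smul, one_smul]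
      rw [this, smul_smul, inv_mul_cancel₀ hD0, one_smul]
    · rw [smul_smul, mul_inv_cancel₀ hD0, one_smul, add_sub_cancel, add_sub_cancel, smul_smul,
        inv_mul_cancel₀ (by linarith), one_smul]
      exact hfree

theorem HasLastParty.signallingRobustness_le (hd : ∀ l, 0 < d l) {W : Op d}
    (hW : HasLastParty (Fin.last n) W) :
    IsLeast (robustnessSet W) (signallingRobustness W) ∧
      signallingRobustness W ≤ (∏ i : Fin n, (d (out i.castSucc) : ℝ) ^ 2) - 1 := by
  have h := isLeast_signallingRobustness hd (hW.mem_robustnessSet hd)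
  exact ⟨h, h.2 (hW.mem_robustnessSet hd)⟩

end LastParty

end ProcMat

theorem mainTheorem3 (n : ℕ) (d : ProcMat.Leg (n + 1) → ℕ) (hd : ∀ l, 0 < d l) :
    (∀ W : ProcMat.Op d, ProcMat.IsCausallyOrdered W →
      IsLeast (ProcMat.robustnessSet W) (ProcMat.signallingRobustness W) ∧
      ProcMat.signallingRobustness W
        ≤ (∏ i : Fin n, (d (ProcMat.out i.castSucc) : ℝ) ^ 2) - 1) ∧
    (∀ W : ProcMat.Op d, ProcMat.HasLastParty (Fin.last n) W →
      IsLeast (ProcMat.robustnessSet W) (ProcMat.signallingRobustness W) ∧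
      ProcMat.signallingRobustness W
        ≤ (∏ i : Fin n, (d (ProcMat.out i.castSucc) : ℝ) ^ 2) - 1) :=
  ⟨fun _ hW => (hW.hasLastParty hd).signallingRobustness_le hd,
    fun _ hW => hW.signallingRobustness_le hd⟩
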